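/- Let $K$ be a field of characteristic zero, $n\in\mathbb N_0$, and $q_1,\dots,q_n\in K\setminus\{0\}$. Let $Q_n$ be the $n$th $\underline q$-Weyl algebra, i.e. the $K$-algebra generated by $x_1,\dots,x_n,\partial_1,\dots,\partial_n$ with relations $x_ix_j=x_jx_i$, $\partial_i\partial_j=\partial_j\partial_i$, $\partial_ix_j=x_j\partial_i$ for $i\ne j$, and $\partial_ix_i=q_ix_i\partial_i+1$; for $q_1=\dots=q_n=1$ it is the $n$th Weyl algebra $A_n$. Put $\theta_i=x_i\partial_i$ and $K[\underline\theta]=K[\theta_1,\dots,\theta_n]$. For $z\in\mathbb Z^n$ let $Q_n^{(z)}$ be the $K$-span of the monomials $X^aD^b=x_1^{a_1}\cdots x_n^{a_n}\partial_1^{b_1}\cdots\partial_n^{b_n}$ with $a,b\in\mathbb N_0^n$, $b-a=z$, and put $e_i=\max(-z_i,0)$, $w_i=\max(z_i,0)$. A *nontrivial factorization* of $p\in Q_n$ is a tuple $(c,f_1,\dots,f_m)$ with $m\ge 0$, $c\in K\setminus\{0\}$, $f_i\in Q_n\setminus K$ and $p=c\,f_1\cdots f_m$. (The factors may be normalized to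 be monic, but need not be.) Consider the following operations on such tuples. (i) *Swapping*: replacing two adjacent factors by means of one of the commutation rules, read in either direction: $f(\underline\theta)\cdot g(\underline\theta)=g(\underline\theta)\cdot f(\underline\theta)$; $f(\underline\theta)\cdot x_i=x_i\cdot f(\dots,q_i\theta_i+1,\dots)$; $f(\underline\theta)\cdot\partial_i=\partial_i\cdot f(\dots,(\theta_i-1)/q_i,\dots)$; $x_i\cdot x_j=x_j\cdot x_i$; $\partial_i\cdot\partial_j=\partial_j\cdot\partial_i$; $x_i\cdot\partial_j=\partial_j\cdot x_i$ for $i\neq j$. (ii) *Rewriting*: replacing a factor $\theta_i$ by the two factors $x_i,\partial_i$, or a factor $\theta_i+\frac1{q_i}$ by the two factors $\partial_i,x_i$ and at the same time $c$ by $c/q_i$ (note $\partial_ix_i=q_i(\theta_i+\frac1{q_i})$; in $A_n$ this factor is $\theta_i+1=\partial_ix_i$). Moreover, nonzero constants may be moved freely between $c$ and the factors. A tuple is *derivable* from another one if it arises from it by finitely many of these operations. **Lemma.** Let $z\in\mathbb Z^n$ and $p\in Q_n^{(z)}$, and suppose that $$p=c_0\cdot Q(\underline\theta)\cdot T(\underline\theta)\cdot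 X^eD^w,\qquad T(\underline\theta)=\prod_{i=1}^n\theta_i^{t_i}\Bigl(\theta_i+\frac1{q_i}\Bigr)^{s_i},\qquad t_i,s_i\in\mathbb N_0,$$ where $c_0\in K\setminus\{0\}$ and $Q(\underline\theta)$ is a finite product of polynomials that are irreducible both in $K[\underline\theta]$ and in $Q_n$. Let $F_0$ be the tuple consisting of $c_0$, the given irreducible factors of $Q(\underline\theta)$, the factors $\theta_i$ and $\theta_i+\frac1{q_i}$ of $T(\underline\theta)$ with their multiplicities, and the single variables in $X^eD^w$, in this order. 1. Every nontrivial factorization of $p$ all of whose factors are irreducible in $Q_n$ is derivable from $F_0$. 2. For every nontrivial factorization $(c,f_1,\dots,f_m)$ of $p$ (with possibly reducible factors) there is a tuple $(c,g_1,\dots,g_k)$ derivable from $F_0$ such that $f_1,\dots,f_m$ are the products of consecutive blocks of $g_1,\dots,g_k$. -/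

import Mathlib

noncomputable section

/-- The defining relations of the `n`-th `q`-Weyl algebra; `Sum.inl i` stands for `x_i` and
`Sum.inr i` for `∂_i`. -/
inductive QWeylRel {K : Type*} [Field K] {n : ℕ} (q : Fin n → Kˣ) :
    FreeAlgebra K (Fin n ⊕ Fin n) → FreeAlgebra K (Fin n ⊕ Fin n) → Prop
  | x_x (i j : Fin n) : QWeylRel q
      (FreeAlgebra.ι K (Sum.inl i) * FreeAlgebra.ι K (Sum.inl j))
      (FreeAlgebra.ι K (Sum.inl j) * FreeAlgebra.ι K (Sum.inl i))
  | d_d (i j : Fin n) : QWeylRel q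
      (FreeAlgebra.ι K (Sum.inr i) * FreeAlgebra.ι K (Sum.inr j))
      (FreeAlgebra.ι K (Sum.inr j) * FreeAlgebra.ι K (Sum.inr i))
  | d_x_of_ne (i j : Fin n) (h : i ≠ j) : QWeylRel q
      (FreeAlgebra.ι K (Sum.inr i) * FreeAlgebra.ι K (Sum.inl j))
      (FreeAlgebra.ι K (Sum.inl j) * FreeAlgebra.ι K (Sum.inr i))
  | d_x_self (i : Fin n) : QWeylRel q
      (FreeAlgebra.ι K (Sum.inr i) * FreeAlgebra.ι K (Sum.inl i))
      ((q i : K) • (FreeAlgebra.ι K (Sum.inl i) * FreeAlgebra.ι K (Sum.inr i)) + 1)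

/-- The `n`-th `q`-Weyl algebra `Q_n`, given by generators and relations.
For `q = 1` this is the `n`-th Weyl algebra `A_n`. -/
abbrev QWeyl {K : Type*} [Field K] {n : ℕ} (q : Fin n → Kˣ) : Type _ := RingQuot (QWeylRel q)

namespace QWeyl

variable {K : Type*} [Field K] {n : ℕ} (q : Fin n → Kˣ)

/-- The generator `x_i`. -/
def x (i : Fin n) : QWeyl q :=
  RingQuot.mkAlgHom K (QWeylRel q) (FreeAlgebra.ι K (Sum.inl i))

/-- The generator `∂_i`. -/
def d (i : Fin n) : QWeyl q :=
  RingQuot.mkAlgHom K (QWeylRel q) (FreeAlgebra.ι K (Sum.inr i))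

/-- The monomial `X^a D^b = x_1^{a_1} ⋯ x_n^{a_n} ∂_1^{b_1} ⋯ ∂_n^{b_n}`. -/
def monomial (a b : Fin n → ℕ) : QWeyl q :=
  (List.ofFn fun i => x q i ^ a i).prod * (List.ofFn fun i => d q i ^ b i).prod

/-- The graded part `Q_n^{(z)}`, spanned by the monomials `X^a D^b` with `b - a = z`. -/
def gradedPart (z : Fin n → ℤ) : Submodule K (QWeyl q) :=
  Submodule.span K
    {m | ∃ a b : Fin n → ℕ, (∀ i, (b i : ℤ) - (a i : ℤ) = z i) ∧ m = monomial q a b}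

/-- The Euler operator `θ_i = x_i ∂_i`. -/
def theta (i : Fin n) : QWeyl q := x q i * d q i

/-- The value `f(θ_1, …, θ_n)` of a commutative polynomial `f`, as an element of `Q_n`. -/
def evalTheta (f : MvPolynomial (Fin n) K) : QWeyl q :=
  ∑ m ∈ f.support, f.coeff m • (List.ofFn fun i => theta q i ^ m i).prod

/-- The substitution `θ_i ↦ q_i θ_i + 1`, for which `f(θ) x_i = x_i (shiftX i f)(θ)`. -/
def shiftX (i : Fin n) : MvPolynomial (Fin n) K →ₐ[K] MvPolynomial (Fin n) K :=
  MvPolynomial.aeval (Function.update MvPolynomial.X i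
    (MvPolynomial.C (q i : K) * MvPolynomial.X i + 1))

/-- The substitution `θ_i ↦ (θ_i - 1) / q_i`, for which `f(θ) ∂_i = ∂_i (shiftD i f)(θ)`. -/
def shiftD (i : Fin n) : MvPolynomial (Fin n) K →ₐ[K] MvPolynomial (Fin n) K :=
  MvPolynomial.aeval (Function.update MvPolynomial.X i
    (MvPolynomial.C (q i : K)⁻¹ * (MvPolynomial.X i - 1)))

/-- `Commutation q a b b' a'`: the product `a * b` of two adjacent factors may be replaced by
`b' * a'` according to one of the commutation rules between polynomials in `θ_1, …, θ_n` and
generators, or between two generators that commute. -/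
inductive Commutation : QWeyl q → QWeyl q → QWeyl q → QWeyl q → Prop
  | theta_theta (f g : MvPolynomial (Fin n) K) :
      Commutation (evalTheta q f) (evalTheta q g) (evalTheta q g) (evalTheta q f)
  | theta_x (f : MvPolynomial (Fin n) K) (i : Fin n) :
      Commutation (evalTheta q f) (x q i) (x q i) (evalTheta q (shiftX q i f))
  | theta_d (f : MvPolynomial (Fin n) K) (i : Fin n) :
      Commutation (evalTheta q f) (d q i) (d q i) (evalTheta q (shiftD q i f))
  | x_x (i j : Fin n) : Commutation (x q i) (x q j) (x q j) (x q i)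
  | d_d (i j : Fin n) : Commutation (d q i) (d q j) (d q j) (d q i)
  | x_d (i j : Fin n) (h : i ≠ j) : Commutation (x q i) (d q j) (d q j) (x q i)

/-- One operation on a factorization, which is stored as a pair `(c, [f_1, …, f_m])` and stands
for `c • f_1 ⋯ f_m`:
* swapping two adjacent factors by a commutation rule, read in either direction;
* rewriting a factor `θ_i` as the two factors `x_i, ∂_i`;
* rewriting a factor `θ_i + 1 / q_i` as the two factors `∂_i, x_i`
  (note `∂_i x_i = q_i (θ_i + 1 / q_i)`);
* renormalizing, that is, moving a nonzero constant between `c` and a factor. -/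
inductive Step : K × List (QWeyl q) → K × List (QWeyl q) → Prop
  | swap (c : K) (u v : List (QWeyl q)) (a b b' a' : QWeyl q) (h : Commutation q a b b' a') :
      Step (c, u ++ [a, b] ++ v) (c, u ++ [b', a'] ++ v)
  | swap_symm (c : K) (u v : List (QWeyl q)) (a b b' a' : QWeyl q)
      (h : Commutation q a b b' a') :
      Step (c, u ++ [b', a'] ++ v) (c, u ++ [a, b] ++ v)
  | rewrite_theta (c : K) (u v : List (QWeyl q)) (i : Fin n) :
      Step (c, u ++ [theta q i] ++ v) (c, u ++ [x q i, d q i] ++ v)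
  | rewrite_theta_add (c : K) (u v : List (QWeyl q)) (i : Fin n) :
      Step (c, u ++ [theta q i + algebraMap K (QWeyl q) (q i : K)⁻¹] ++ v)
        (c * (q i : K)⁻¹, u ++ [d q i, x q i] ++ v)
  | renormalize (c a : K) (ha : a ≠ 0) (u v : List (QWeyl q)) (f : QWeyl q) :
      Step (c * a, u ++ [f] ++ v) (c, u ++ [a • f] ++ v)

/-- `Derivable q F G`: the factorization `G` arises from `F` by finitely many operations. -/
def Derivable (F G : K × List (QWeyl q)) : Prop := Relation.ReflTransGen (Step q) F G

/-- `(c, [f_1, …, f_m])` is a nontrivial factorization of `p`: `c` is a nonzero constant, no `f_i`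
is a constant, and `p = c • f_1 ⋯ f_m`. The factors may have any normalization, in particular they
may all be monic (a monic element is a constant only if it is `1`). -/
def IsNontrivialFactorization (p : QWeyl q) (F : K × List (QWeyl q)) : Prop :=
  F.1 ≠ 0 ∧ (∀ f ∈ F.2, f ∉ Set.range (algebraMap K (QWeyl q))) ∧ p = F.1 • F.2.prod

/-- The factors of `T(θ) = ∏ θ_i^{t_i} (θ_i + 1 / q_i)^{s_i}`. -/
def factorsT (t s : Fin n → ℕ) : List (QWeyl q) :=
  (List.ofFn fun i => List.replicate (t i) (theta q i) ++
    List.replicate (s i) (theta q i + algebraMap K (QWeyl q) (q i : K)⁻¹)).flatten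

/-- The single variables in `X^{e(z)} D^{w(z)}`, where `e(z)_i = max (-z_i) 0` and
`w(z)_i = max z_i 0`. -/
def factorsXD (z : Fin n → ℤ) : List (QWeyl q) :=
  (List.ofFn fun i => List.replicate (-z i).toNat (x q i)).flatten ++
    (List.ofFn fun i => List.replicate (z i).toNat (d q i)).flatten

end QWeyl

end

/-!
Let `ℤ^n` act on `K[θ]` by the `q`-shifts, so that `∂_i ↦ u_i` and `x_i ↦ θ_i u_i⁻¹` define a
homomorphism from `Q_n` to the skew group ring `K[θ] ⋊ ℤ^n`. Since `ℤ^n` has two unique products,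
every factor of a homogeneous element is homogeneous. Moreover `Q_n` is spanned by the elements
`g(θ) X^{e(z)} D^{w(z)}`, hence every homogeneous element has this form and is, up to a constant, a
product of letters: irreducible polynomials in `θ` and generators.

Reading the operations backwards, a tuple of letters is brought into a normal form, with the
polynomials in `θ` on the left and the variables of `X^{e(z)} D^{w(z)}` on the right: the rules
move a polynomial to the left of a generator, and `x_i ∂_i` and `∂_i x_i` are rewritten as
polynomials. Two normal forms with the same value have the same `z`, and unique factorization in
`K[θ]` derives one from the other. So `F₀`, being a normal form, derives every tuple of letters with
value `p`. In particular a letter has no right inverse, because no operation applies to the empty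
tuple, and therefore an irreducible homogeneous element is itself a letter.
-/

section SkewMonoidAlgebra

lemma exists_eq_single_of_card_support_eq_one {k G : Type*} [AddCommMonoid k]
    {a : SkewMonoidAlgebra k G} (ha : a.support.card = 1) :
    ∃ g r, r ≠ 0 ∧ a = SkewMonoidAlgebra.single g r := by
  classical
  obtain ⟨g, hg⟩ := Finset.card_eq_one.mp ha
  refine ⟨g, a.coeff g, ?_, ?_⟩
  · rw [← SkewMonoidAlgebra.mem_support_iff, hg]
    exact Finset.mem_singleton_self g
  · ext h
    rw [SkewMonoidAlgebra.coeff_single_apply]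
    split_ifs with hgh
    · rw [hgh]
    · rw [← SkewMonoidAlgebra.notMem_support_iff, hg, Finset.mem_singleton]
      exact Ne.symm hgh

lemma coeff_mul_of_uniqueMul {k G : Type*} [Semiring k] [LeftCancelMonoid G]
    [MulSemiringAction G k] {a b : SkewMonoidAlgebra k G} {g h : G}
    (hgh : UniqueMul a.support b.support g h) :
    (a * b).coeff (g * h) = a.coeff g * g • b.coeff h := by
  classical
  simp only [SkewMonoidAlgebra.coeff_mul, SkewMonoidAlgebra.sum_def']
  rw [Finset.sum_eq_single g, Finset.sum_eq_single h, if_pos rfl]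
  · exact fun h' _ hne => if_neg fun heq => hne (mul_left_cancel heq)
  · intro hh
    rw [if_pos rfl, SkewMonoidAlgebra.notMem_support_iff.mp hh, smul_zero, mul_zero]
  · exact fun g' hg' hne => Finset.sum_eq_zero fun h' hh' =>
      if_neg fun heq => hne (hgh hg' hh' heq).1
  · intro hg
    exact Finset.sum_eq_zero fun h' _ => by
      simp only [SkewMonoidAlgebra.notMem_support_iff.mp hg, zero_mul, ite_self]

variable {k G : Type*} [Semiring k] [Group G] [MulSemiringAction G k]

lemma mul_mem_support_of_uniqueMul [NoZeroDivisors k] {a b : SkewMonoidAlgebra k G} {g h : G}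
    (hg : g ∈ a.support) (hh : h ∈ b.support) (hgh : UniqueMul a.support b.support g h) :
    g * h ∈ (a * b).support := by
  rw [SkewMonoidAlgebra.mem_support_iff] at hg hh ⊢
  rw [coeff_mul_of_uniqueMul hgh]
  exact mul_ne_zero hg ((smul_ne_zero_iff_ne g).mpr hh)

lemma exists_eq_single_of_mul_eq_single [NoZeroDivisors k] [TwoUniqueProds G]
    {a b : SkewMonoidAlgebra k G} {l : G} {r : k} (hr : r ≠ 0)
    (hab : a * b = SkewMonoidAlgebra.single l r) :
    (∃ g s, s ≠ 0 ∧ a = SkewMonoidAlgebra.single g s) ∧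
      ∃ h t, t ≠ 0 ∧ b = SkewMonoidAlgebra.single h t := by
  classical
  have hab₀ : a * b ≠ 0 := by
    rw [hab, Ne, SkewMonoidAlgebra.single_eq_zero]
    exact hr
  have ha : 0 < a.support.card := by
    rw [Finset.card_pos, Finset.nonempty_iff_ne_empty, Ne, SkewMonoidAlgebra.support_eq_empty]
    exact left_ne_zero_of_mul hab₀
  have hb : 0 < b.support.card := by
    rw [Finset.card_pos, Finset.nonempty_iff_ne_empty, Ne, SkewMonoidAlgebra.support_eq_empty]
    exact right_ne_zero_of_mul hab₀
  have hsupport {g h : G} (hg : g ∈ a.support) (hh : h ∈ b.support)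
      (hgh : UniqueMul a.support b.support g h) : g * h = l := by
    have := mul_mem_support_of_uniqueMul hg hh hgh
    rw [hab, SkewMonoidAlgebra.mem_support_iff, SkewMonoidAlgebra.coeff_single_apply] at this
    exact (of_not_not fun hne => this (if_neg hne)).symm
  have hcard : a.support.card * b.support.card = 1 := by
    refine le_antisymm (not_lt.mp fun hlt => ?_) (Nat.mul_pos ha hb)
    obtain ⟨⟨g, h⟩, hmem, ⟨g', h'⟩, hmem', hne, hu, hu'⟩ :=
      TwoUniqueProds.uniqueMul_of_one_lt_card hlt
    rw [Finset.mem_product] at hmem hmem'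
    obtain ⟨rfl, rfl⟩ := hu hmem'.1 hmem'.2
      ((hsupport hmem'.1 hmem'.2 hu').trans (hsupport hmem.1 hmem.2 hu).symm)
    exact hne rfl
  exact (mul_eq_one.mp hcard).imp exists_eq_single_of_card_support_eq_one
    exists_eq_single_of_card_support_eq_one

end SkewMonoidAlgebra

lemma semiconjBy_of_forall_X {R σ A : Type*} [CommSemiring R] [Semiring A] [Algebra R A]
    {φ ψ : MvPolynomial σ R →ₐ[R] A} {a : A}
    (h : ∀ i, SemiconjBy a (φ (MvPolynomial.X i)) (ψ (MvPolynomial.X i)))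
    (f : MvPolynomial σ R) : SemiconjBy a (φ f) (ψ f) := by
  induction f using MvPolynomial.induction_on with
  | C r =>
    rw [← MvPolynomial.algebraMap_eq, AlgHom.commutes, AlgHom.commutes]
    exact (Algebra.commutes r a).symm
  | add f g hf hg =>
    rw [map_add, map_add]
    exact hf.add_right hg
  | mul_X f i hf =>
    rw [map_mul, map_mul]
    exact hf.mul_right (h i)

lemma exists_unit_smul_eq_of_associated {R σ : Type*} [CommRing R] [IsReduced R]
    {f g : MvPolynomial σ R} (h : Associated f g) : ∃ u : Rˣ, (u : R) • f = g := by
  obtain ⟨u, rfl⟩ := h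
  obtain ⟨r, hr, hu⟩ := MvPolynomial.isUnit_iff_eq_C_of_isReduced.mp u.isUnit
  refine ⟨hr.unit, ?_⟩
  rw [hu, MvPolynomial.smul_eq_C_mul, mul_comm, IsUnit.unit_spec]

lemma exists_eq_singleton_of_irreducible_prod {M : Type*} [Monoid M] {l : List M}
    (hl : Irreducible l.prod) (hone : ∀ a ∈ l, ∀ b, a * b ≠ 1) : ∃ a, l = [a] := by
  match l with
  | [] => exact absurd hl not_irreducible_one
  | [a] => exact ⟨a, rfl⟩
  | a :: b :: l' =>
    rw [List.prod_cons, List.prod_cons] at hl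
    rcases hl.isUnit_or_isUnit rfl with ha | hb
    · obtain ⟨c, hc⟩ := ha.exists_right_inv
      exact absurd hc (hone a (by simp) c)
    · obtain ⟨c, hc⟩ := hb.exists_right_inv
      rw [mul_assoc] at hc
      exact absurd hc (hone b (by simp) _)

noncomputable section

namespace QWeyl

open MvPolynomial

variable {K : Type*} [Field K] {n : ℕ} (q : Fin n → Kˣ)

section Relations

lemma x_mul_x (i j : Fin n) : x q i * x q j = x q j * x q i := by
  simpa [x] using RingQuot.mkAlgHom_rel K (QWeylRel.x_x (q := q) i j)

lemma d_mul_d (i j : Fin n) : d q i * d q j = d q j * d q i := by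
  simpa [d] using RingQuot.mkAlgHom_rel K (QWeylRel.d_d (q := q) i j)

lemma d_mul_x_of_ne {i j : Fin n} (h : i ≠ j) : d q i * x q j = x q j * d q i := by
  simpa [x, d] using RingQuot.mkAlgHom_rel K (QWeylRel.d_x_of_ne (q := q) i j h)

lemma d_mul_x_self (i : Fin n) : d q i * x q i = (q i : K) • theta q i + 1 := by
  simpa [x, d, theta] using RingQuot.mkAlgHom_rel K (QWeylRel.d_x_self (q := q) i)

lemma d_mul_x_self_eq_smul (i : Fin n) :
    d q i * x q i = (q i : K) • (theta q i + algebraMap K (QWeyl q) (q i : K)⁻¹) := by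
  rw [d_mul_x_self, smul_add, Algebra.algebraMap_eq_smul_one, smul_smul,
    mul_inv_cancel₀ (q i).ne_zero, one_smul]

lemma theta_mul_x_self (i : Fin n) : theta q i * x q i = x q i * ((q i : K) • theta q i + 1) := by
  rw [theta, mul_assoc, d_mul_x_self, theta]

lemma theta_mul_x_of_ne {i j : Fin n} (h : i ≠ j) : theta q i * x q j = x q j * theta q i := by
  rw [theta, mul_assoc, d_mul_x_of_ne q h, ← mul_assoc, x_mul_x, mul_assoc]

lemma theta_mul_d_of_ne {i j : Fin n} (h : i ≠ j) : theta q i * d q j = d q j * theta q i := by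
  rw [theta, mul_assoc, d_mul_d, ← mul_assoc, ← d_mul_x_of_ne q h.symm, mul_assoc]

lemma theta_mul_d_self (i : Fin n) :
    theta q i * d q i = d q i * ((q i : K)⁻¹ • (theta q i - 1)) := by
  have hd : d q i * theta q i = (q i : K) • (theta q i * d q i) + d q i := by
    rw [theta, ← mul_assoc, d_mul_x_self, theta, add_mul, smul_mul_assoc, one_mul]
  rw [mul_smul_comm, mul_sub, hd, mul_one, add_sub_cancel_right, smul_smul,
    inv_mul_cancel₀ (q i).ne_zero, one_smul]

lemma theta_mul_theta (i j : Fin n) : theta q i * theta q j = theta q j * theta q i := by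
  rcases eq_or_ne i j with rfl | h
  · rfl
  · rw [theta.eq_def q j, ← mul_assoc, theta_mul_x_of_ne q h, mul_assoc, theta_mul_d_of_ne q h,
      mul_assoc]

end Relations

section Shift

lemma shiftX_X_self (i : Fin n) : shiftX q i (X i) = C (q i : K) * X i + 1 := by
  rw [shiftX, aeval_X, Function.update_self]

lemma shiftX_X_of_ne {i j : Fin n} (h : j ≠ i) : shiftX q i (X j) = X j := by
  rw [shiftX, aeval_X, Function.update_of_ne h]

lemma shiftD_X_self (i : Fin n) : shiftD q i (X i) = C (q i : K)⁻¹ * (X i - 1) := by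
  rw [shiftD, aeval_X, Function.update_self]

lemma shiftD_X_of_ne {i j : Fin n} (h : j ≠ i) : shiftD q i (X j) = X j := by
  rw [shiftD, aeval_X, Function.update_of_ne h]

lemma shiftX_C (i : Fin n) (a : K) : shiftX q i (C a) = C a := algHom_C _ a

lemma shiftD_C (i : Fin n) (a : K) : shiftD q i (C a) = C a := algHom_C _ a

lemma C_mul_C_inv (i : Fin n) : (C (q i : K) * C (q i : K)⁻¹ : MvPolynomial (Fin n) K) = 1 := by
  rw [← map_mul, mul_inv_cancel₀ (q i).ne_zero, map_one]

/-- The substitution `θ_i ↦ q_i θ_i + 1` as an automorphism of `K[θ]`. -/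
def shiftEquiv (i : Fin n) : MvPolynomial (Fin n) K ≃ₐ[K] MvPolynomial (Fin n) K :=
  AlgEquiv.ofAlgHom (shiftX q i) (shiftD q i)
    (algHom_ext fun j => by
      rw [AlgHom.comp_apply, AlgHom.id_apply]
      rcases eq_or_ne j i with rfl | h
      · rw [shiftD_X_self, map_mul, map_sub, shiftX_C, shiftX_X_self, map_one, add_sub_cancel_right,
          mul_left_comm, ← mul_assoc, C_mul_C_inv, one_mul]
      · rw [shiftD_X_of_ne q h, shiftX_X_of_ne q h])
    (algHom_ext fun j => by
      rw [AlgHom.comp_apply, AlgHom.id_apply]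
      rcases eq_or_ne j i with rfl | h
      · rw [shiftX_X_self, map_add, map_mul, shiftD_C, shiftD_X_self, map_one, ← mul_assoc,
          C_mul_C_inv, one_mul, sub_add_cancel]
      · rw [shiftX_X_of_ne q h, shiftD_X_of_ne q h])

lemma shiftEquiv_apply (i : Fin n) (f : MvPolynomial (Fin n) K) :
    shiftEquiv q i f = shiftX q i f := rfl

lemma shiftX_shiftD (i : Fin n) (f : MvPolynomial (Fin n) K) :
    shiftX q i (shiftD q i f) = f :=
  (shiftEquiv q i).apply_symm_apply f

lemma shiftD_shiftX (i : Fin n) (f : MvPolynomial (Fin n) K) :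
    shiftD q i (shiftX q i f) = f :=
  (shiftEquiv q i).symm_apply_apply f

lemma commute_shiftEquiv (i j : Fin n) : Commute (shiftEquiv q i) (shiftEquiv q j) := by
  rcases eq_or_ne i j with rfl | hij
  · rfl
  refine AlgEquiv.coe_toAlgHom_injective (algHom_ext fun k => ?_)
  change shiftX q i (shiftX q j (X k)) = shiftX q j (shiftX q i (X k))
  rcases eq_or_ne k i with rfl | hi
  · simp [shiftX_X_self, shiftX_X_of_ne q hij]
  · rcases eq_or_ne k j with rfl | hj
    · simp [shiftX_X_self, shiftX_X_of_ne q hi]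
    · simp [shiftX_X_of_ne q hi, shiftX_X_of_ne q hj]

end Shift

section EvalTheta

open scoped IsMulCommutative

instance : IsMulCommutative (Algebra.adjoin K (Set.range (theta q))) :=
  Algebra.isMulCommutative_adjoin K <| by
    rintro _ ⟨i, rfl⟩ _ ⟨j, rfl⟩
    exact theta_mul_theta q i j

/-- The evaluation `f ↦ f(θ_1, …, θ_n)` as an algebra homomorphism. As `Q_n` is not commutative,
it is defined with values in the commutative subalgebra generated by the `θ_i`. -/
def evalThetaHom : MvPolynomial (Fin n) K →ₐ[K] QWeyl q :=
  (Algebra.adjoin K (Set.range (theta q))).val.comp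
    (aeval fun i => ⟨theta q i, Algebra.subset_adjoin ⟨i, rfl⟩⟩)

lemma evalThetaHom_apply (f : MvPolynomial (Fin n) K) : evalThetaHom q f = evalTheta q f := by
  rw [evalThetaHom, AlgHom.comp_apply, aeval_def, eval₂_eq', map_sum, evalTheta]
  refine Finset.sum_congr rfl fun m _ => ?_
  rw [map_mul, AlgHom.commutes, ← Algebra.smul_def, ← List.prod_ofFn, map_list_prod, List.map_ofFn]
  rfl

lemma coe_evalThetaHom : ⇑(evalThetaHom q) = evalTheta q := funext (evalThetaHom_apply q)

lemma evalThetaHom_X (i : Fin n) : evalThetaHom q (X i) = theta q i := by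
  rw [evalThetaHom, AlgHom.comp_apply, aeval_X, Subalgebra.val_apply]

lemma evalThetaHom_mul_x (f : MvPolynomial (Fin n) K) (i : Fin n) :
    evalThetaHom q f * x q i = x q i * evalThetaHom q (shiftX q i f) := by
  refine (semiconjBy_of_forall_X (φ := (evalThetaHom q).comp (shiftX q i)) (fun j => ?_) f).symm
  rw [SemiconjBy, AlgHom.comp_apply, evalThetaHom_X]
  rcases eq_or_ne j i with rfl | h
  · rw [shiftX_X_self, map_add, map_mul, map_one, ← algebraMap_eq, AlgHom.commutes,
      evalThetaHom_X, theta_mul_x_self, Algebra.smul_def]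
  · rw [shiftX_X_of_ne q h, evalThetaHom_X, theta_mul_x_of_ne q h]

lemma evalThetaHom_mul_d (f : MvPolynomial (Fin n) K) (i : Fin n) :
    evalThetaHom q f * d q i = d q i * evalThetaHom q (shiftD q i f) := by
  refine (semiconjBy_of_forall_X (φ := (evalThetaHom q).comp (shiftD q i)) (fun j => ?_) f).symm
  rw [SemiconjBy, AlgHom.comp_apply, evalThetaHom_X]
  rcases eq_or_ne j i with rfl | h
  · rw [shiftD_X_self, map_mul, map_sub, map_one, ← algebraMap_eq, AlgHom.commutes,
      evalThetaHom_X, theta_mul_d_self, Algebra.smul_def]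
  · rw [shiftD_X_of_ne q h, evalThetaHom_X, theta_mul_d_of_ne q h]

end EvalTheta

section SkewRing

/-- The group `ℤ^n` of degrees, written multiplicatively. It depends on `q` because it acts on
`K[θ]` by `q`-shifts. -/
def ShiftGroup (_ : Fin n → Kˣ) : Type := Fin n → Multiplicative ℤ

instance : CommGroup (ShiftGroup q) := inferInstanceAs (CommGroup (Fin n → Multiplicative ℤ))

instance : TwoUniqueProds (ShiftGroup q) :=
  inferInstanceAs (TwoUniqueProds (Fin n → Multiplicative ℤ))

/-- The element of `ShiftGroup q` attached to a degree `z ∈ ℤ^n`. -/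
def degree : (Fin n → ℤ) ≃ ShiftGroup q := Equiv.piCongrRight fun _ => Multiplicative.ofAdd

lemma degree_zero : degree q 0 = 1 := rfl

lemma degree_add (z z' : Fin n → ℤ) : degree q (z + z') = degree q z * degree q z' := rfl

lemma degree_single (i : Fin n) (m : ℤ) :
    degree q (Pi.single i m) = Pi.mulSingle (M := fun _ => Multiplicative ℤ) i (.ofAdd m) := by
  funext j
  change Multiplicative.ofAdd ((Pi.single i m : Fin n → ℤ) j) = _
  rcases eq_or_ne j i with rfl | h
  · simp
  · simp [h]

/-- The action of `ℤ^n` on `K[θ]` in which the `i`-th unit vector, the degree of `∂_i`, acts by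
`θ_i ↦ q_i θ_i + 1`. -/
def shiftHom : ShiftGroup q →* (MvPolynomial (Fin n) K ≃ₐ[K] MvPolynomial (Fin n) K) :=
  MonoidHom.noncommPiCoprod (fun i => zpowersHom _ (shiftEquiv q i))
    fun i j _ _ _ => (commute_shiftEquiv q i j).zpow_zpow _ _

lemma shiftHom_degree_single (i : Fin n) (m : ℤ) :
    shiftHom q (degree q (Pi.single i m)) = shiftEquiv q i ^ m := by
  rw [degree_single]
  exact MonoidHom.noncommPiCoprod_mulSingle _ i _

instance : MulSemiringAction (ShiftGroup q) (MvPolynomial (Fin n) K) :=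
  MulSemiringAction.compHom _ (shiftHom q)

instance : SMulCommClass (ShiftGroup q) K (MvPolynomial (Fin n) K) :=
  ⟨fun g c f => map_smul (shiftHom q g) c f⟩

lemma degree_single_one_smul (i : Fin n) (f : MvPolynomial (Fin n) K) :
    degree q (Pi.single i 1) • f = shiftX q i f := by
  change shiftHom q _ f = _
  rw [shiftHom_degree_single, zpow_one, shiftEquiv_apply]

lemma degree_neg_single_one_smul (i : Fin n) (f : MvPolynomial (Fin n) K) :
    degree q (-Pi.single i 1) • f = shiftD q i f := by
  change shiftHom q _ f = _
  rw [← Pi.single_neg, shiftHom_degree_single, zpow_neg_one]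
  rfl

/-- The skew group ring `K[θ] ⋊ ℤ^n`, to which `Q_n` is mapped in order to compare degrees. -/
abbrev SkewRing : Type _ := SkewMonoidAlgebra (MvPolynomial (Fin n) K) (ShiftGroup q)

/-- The images of the generators of `Q_n` in the skew group ring: with `u_i` the `i`-th unit of
the group, `∂_i ↦ u_i` and `x_i = θ_i ∂_i⁻¹ ↦ θ_i u_i⁻¹`. -/
def toSkewGen : Fin n ⊕ Fin n → SkewRing q
  | Sum.inl i => SkewMonoidAlgebra.single (degree q (-Pi.single i 1)) (X i)
  | Sum.inr i => SkewMonoidAlgebra.single (degree q (Pi.single i 1)) 1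

lemma lift_toSkewGen_eq_of_rel {a b : FreeAlgebra K (Fin n ⊕ Fin n)} (h : QWeylRel q a b) :
    FreeAlgebra.lift K (toSkewGen q) a = FreeAlgebra.lift K (toSkewGen q) b := by
  induction h with
  | x_x i j =>
    rcases eq_or_ne i j with rfl | h
    · rfl
    · simp only [map_mul, FreeAlgebra.lift_ι_apply, toSkewGen,
        SkewMonoidAlgebra.single_mul_single, degree_neg_single_one_smul,
        shiftD_X_of_ne q h, shiftD_X_of_ne q h.symm, mul_comm]
  | d_d i j =>
    simp only [map_mul, FreeAlgebra.lift_ι_apply, toSkewGen, SkewMonoidAlgebra.single_mul_single,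
      smul_one, mul_one, mul_comm]
  | d_x_of_ne i j h =>
    simp only [map_mul, FreeAlgebra.lift_ι_apply, toSkewGen, SkewMonoidAlgebra.single_mul_single,
      degree_single_one_smul, shiftX_X_of_ne q h.symm, smul_one, mul_one, mul_comm]
  | d_x_self i =>
    simp only [map_mul, map_add, map_smul, map_one, FreeAlgebra.lift_ι_apply, toSkewGen,
      SkewMonoidAlgebra.single_mul_single, degree_single_one_smul, shiftX_X_self, smul_one,
      mul_one, one_mul, ← degree_add, add_neg_cancel, neg_add_cancel, degree_zero,
      SkewMonoidAlgebra.single_add, SkewMonoidAlgebra.one_def, SkewMonoidAlgebra.smul_single,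
      MvPolynomial.smul_eq_C_mul]

/-- The homomorphism from `Q_n` to the skew group ring. -/
def toSkew : QWeyl q →ₐ[K] SkewRing q :=
  RingQuot.liftAlgHom K
    ⟨FreeAlgebra.lift K (toSkewGen q), fun _ _ h => lift_toSkewGen_eq_of_rel q h⟩

lemma toSkew_x (i : Fin n) :
    toSkew q (x q i) = SkewMonoidAlgebra.single (degree q (-Pi.single i 1)) (X i) := by
  rw [toSkew, x, RingQuot.liftAlgHom_mkAlgHom_apply, FreeAlgebra.lift_ι_apply, toSkewGen]

lemma toSkew_d (i : Fin n) :
    toSkew q (d q i) = SkewMonoidAlgebra.single (degree q (Pi.single i 1)) 1 := by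
  rw [toSkew, d, RingQuot.liftAlgHom_mkAlgHom_apply, FreeAlgebra.lift_ι_apply, toSkewGen]

lemma toSkew_theta (i : Fin n) : toSkew q (theta q i) = SkewMonoidAlgebra.single 1 (X i) := by
  rw [theta, map_mul, toSkew_x, toSkew_d, SkewMonoidAlgebra.single_mul_single, smul_one, mul_one,
    ← degree_add, neg_add_cancel, degree_zero]

lemma toSkew_evalThetaHom (f : MvPolynomial (Fin n) K) :
    toSkew q (evalThetaHom q f) = SkewMonoidAlgebra.single 1 f := by
  induction f using MvPolynomial.induction_on with
  | C a =>
    rw [← algebraMap_eq, AlgHom.commutes, AlgHom.commutes]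
    rfl
  | add f g hf hg => rw [map_add, map_add, hf, hg, SkewMonoidAlgebra.single_add]
  | mul_X f j hf =>
    rw [map_mul, map_mul, hf, evalThetaHom_X, toSkew_theta, SkewMonoidAlgebra.single_mul_single,
      one_mul, one_smul]

end SkewRing

section Homogeneous

/-- The set of nonzero homogeneous elements of `Q_n` of degree `z`, where `x_i` has degree `-1` and
`∂_i` has degree `1` in the `i`-th coordinate, read off in the skew group ring. -/
def homogeneous (z : Fin n → ℤ) : Set (QWeyl q) :=
  {f | ∃ r ≠ 0, toSkew q f = SkewMonoidAlgebra.single (degree q z) r}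

/-- A nonzero homogeneous element of `Q_n`, of any degree. -/
def IsHomogeneous (f : QWeyl q) : Prop := ∃ z, f ∈ homogeneous q z

lemma one_mem_homogeneous : 1 ∈ homogeneous q 0 := ⟨1, one_ne_zero, map_one _⟩

lemma x_mem_homogeneous (i : Fin n) : x q i ∈ homogeneous q (-Pi.single i 1) :=
  ⟨X i, X_ne_zero i, toSkew_x q i⟩

lemma d_mem_homogeneous (i : Fin n) : d q i ∈ homogeneous q (Pi.single i 1) :=
  ⟨1, one_ne_zero, toSkew_d q i⟩

lemma evalThetaHom_mem_homogeneous {f : MvPolynomial (Fin n) K} (hf : f ≠ 0) :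
    evalThetaHom q f ∈ homogeneous q 0 :=
  ⟨f, hf, toSkew_evalThetaHom q f⟩

variable {q}

lemma mul_mem_homogeneous {f g : QWeyl q} {z z' : Fin n → ℤ} (hf : f ∈ homogeneous q z)
    (hg : g ∈ homogeneous q z') : f * g ∈ homogeneous q (z + z') := by
  obtain ⟨r, hr, hfr⟩ := hf
  obtain ⟨s, hs, hgs⟩ := hg
  refine ⟨r * degree q z • s, mul_ne_zero hr ((smul_ne_zero_iff_ne _).mpr hs), ?_⟩
  rw [map_mul, hfr, hgs, SkewMonoidAlgebra.single_mul_single, degree_add]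

lemma prod_ofFn_mem_homogeneous {m : ℕ} {f : Fin m → QWeyl q} {z : Fin m → Fin n → ℤ}
    (h : ∀ i, f i ∈ homogeneous q (z i)) : (List.ofFn f).prod ∈ homogeneous q (∑ i, z i) := by
  induction m with
  | zero => exact one_mem_homogeneous q
  | succ m ih =>
    rw [List.ofFn_succ, List.prod_cons, Fin.sum_univ_succ]
    exact mul_mem_homogeneous (h 0) (ih fun i => h i.succ)

lemma pow_mem_homogeneous {f : QWeyl q} {z : Fin n → ℤ} (hf : f ∈ homogeneous q z) (m : ℕ) :
    f ^ m ∈ homogeneous q (m • z) := by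
  simpa using prod_ofFn_mem_homogeneous fun _ : Fin m => hf

lemma eq_of_mem_homogeneous {f : QWeyl q} {z z' : Fin n → ℤ} (hf : f ∈ homogeneous q z)
    (hf' : f ∈ homogeneous q z') : z = z' := by
  obtain ⟨r, hr, hfr⟩ := hf
  obtain ⟨r', -, hfr'⟩ := hf'
  by_contra hne
  have hcoeff := congrArg (fun a => a.coeff (degree q z)) (hfr.symm.trans hfr')
  simp only [SkewMonoidAlgebra.coeff_single, Finsupp.single_eq_same] at hcoeff
  exact hr (hcoeff.trans (Finsupp.single_eq_of_ne ((degree q).injective.ne hne)))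

lemma evalThetaHom_mul_left_cancel {f g : MvPolynomial (Fin n) K} {z : Fin n → ℤ} {m : QWeyl q}
    (hm : m ∈ homogeneous q z) (h : evalThetaHom q f * m = evalThetaHom q g * m) : f = g := by
  obtain ⟨r, hr, hmr⟩ := hm
  have h := congrArg (toSkew q) h
  simp only [map_mul, toSkew_evalThetaHom, hmr, SkewMonoidAlgebra.single_mul_single, one_mul,
    one_smul] at h
  exact mul_right_cancel₀ hr (SkewMonoidAlgebra.single_injective _ h)

lemma IsHomogeneous.of_mul {f g : QWeyl q} (h : IsHomogeneous q (f * g)) :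
    IsHomogeneous q f ∧ IsHomogeneous q g := by
  have hsingle {f : QWeyl q} (h : ∃ a r, r ≠ 0 ∧ toSkew q f = SkewMonoidAlgebra.single a r) :
      IsHomogeneous q f := by
    obtain ⟨a, r, hr, h⟩ := h
    exact ⟨(degree q).symm a, r, hr, by rw [h, Equiv.apply_symm_apply]⟩
  obtain ⟨z, r, hr, hfg⟩ := h
  rw [map_mul] at hfg
  exact (exists_eq_single_of_mul_eq_single hr hfg).imp hsingle hsingle

lemma IsHomogeneous.of_list_prod {l : List (QWeyl q)} (h : IsHomogeneous q l.prod) :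
    ∀ f ∈ l, IsHomogeneous q f := by
  induction l with
  | nil => simp
  | cons f l ih =>
    rw [List.prod_cons] at h
    exact List.forall_mem_cons.mpr ⟨h.of_mul.1, ih h.of_mul.2⟩

end Homogeneous

section FactorsXD

variable {q} in
lemma mem_factorsXD {z : Fin n → ℤ} {f : QWeyl q} : f ∈ factorsXD q z ↔
    (∃ i, z i < 0 ∧ f = x q i) ∨ ∃ i, 0 < z i ∧ f = d q i := by
  simp [factorsXD, List.mem_ofFn, List.mem_replicate, Int.toNat_eq_zero]

lemma coe_factorsXD (z : Fin n → ℤ) : (factorsXD q z : Multiset (QWeyl q)) =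
    ∑ i, (Multiset.replicate (-z i).toNat (x q i) + Multiset.replicate (z i).toNat (d q i)) := by
  have hflatten (f : Fin n → List (QWeyl q)) :
      ((List.ofFn f).flatten : Multiset (QWeyl q)) = ∑ i, (f i : Multiset (QWeyl q)) := by
    rw [← Multiset.coe_join, List.map_ofFn, Multiset.join, Multiset.sum_coe, List.sum_ofFn]
    rfl
  rw [factorsXD, ← Multiset.coe_add, hflatten, hflatten, Finset.sum_add_distrib]
  rfl

lemma factorsXD_zero : factorsXD q 0 = [] := by
  simp [factorsXD]

lemma factorsXD_sub_single_perm {z : Fin n → ℤ} {i : Fin n} (hz : z i ≤ 0) :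
    (factorsXD q (z - Pi.single i 1)).Perm (x q i :: factorsXD q z) := by
  rw [← Multiset.coe_eq_coe, ← Multiset.cons_coe, coe_factorsXD, coe_factorsXD,
    ← Finset.add_sum_erase _ _ (Finset.mem_univ i), ← Finset.add_sum_erase _ _ (Finset.mem_univ i),
    ← Multiset.cons_add]
  congr 1
  · have hx : (-(z - Pi.single i 1 : Fin n → ℤ) i).toNat = (-z i).toNat + 1 := by
      rw [Pi.sub_apply, Pi.single_eq_same]; omega
    have hd : ((z - Pi.single i 1 : Fin n → ℤ) i).toNat = (z i).toNat := by
      rw [Pi.sub_apply, Pi.single_eq_same]; omega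
    rw [hx, hd, Multiset.replicate_succ, Multiset.cons_add]
  · refine Finset.sum_congr rfl fun j hj => ?_
    rw [Pi.sub_apply, Pi.single_eq_of_ne (Finset.ne_of_mem_erase hj), sub_zero]

lemma factorsXD_add_single_perm {z : Fin n → ℤ} {i : Fin n} (hz : 0 ≤ z i) :
    (factorsXD q (z + Pi.single i 1)).Perm (d q i :: factorsXD q z) := by
  rw [← Multiset.coe_eq_coe, ← Multiset.cons_coe, coe_factorsXD, coe_factorsXD,
    ← Finset.add_sum_erase _ _ (Finset.mem_univ i), ← Finset.add_sum_erase _ _ (Finset.mem_univ i),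
    ← Multiset.cons_add]
  congr 1
  · have hx : (-(z + Pi.single i 1 : Fin n → ℤ) i).toNat = (-z i).toNat := by
      rw [Pi.add_apply, Pi.single_eq_same]; omega
    have hd : ((z + Pi.single i 1 : Fin n → ℤ) i).toNat = (z i).toNat + 1 := by
      rw [Pi.add_apply, Pi.single_eq_same]; omega
    rw [hx, hd, Multiset.replicate_succ, Multiset.add_cons]
  · refine Finset.sum_congr rfl fun j hj => ?_
    rw [Pi.add_apply, Pi.single_eq_of_ne (Finset.ne_of_mem_erase hj), add_zero]

lemma prod_factorsXD_mem_homogeneous (z : Fin n → ℤ) :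
    (factorsXD q z).prod ∈ homogeneous q z := by
  have hx := prod_ofFn_mem_homogeneous fun i =>
    pow_mem_homogeneous (x_mem_homogeneous q i) (-z i).toNat
  have hd := prod_ofFn_mem_homogeneous fun i =>
    pow_mem_homogeneous (d_mem_homogeneous q i) (z i).toNat
  convert mul_mem_homogeneous hx hd using 1
  · congr 1
    funext j
    simp only [smul_neg, nsmul_eq_mul, Finset.sum_neg_distrib, Pi.add_apply, Pi.neg_apply,
      Finset.sum_apply, Pi.mul_apply, Pi.natCast_apply, Int.ofNat_toNat, Pi.single_apply, mul_ite,
      mul_one, mul_zero, Finset.sum_ite_eq, Finset.mem_univ, ↓reduceIte]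
    omega
  · simp [factorsXD, List.prod_flatten, List.map_ofFn, Function.comp_def]

end FactorsXD

section Derivations

variable {q}

lemma Commutation.mul_eq {a b b' a' : QWeyl q} (h : Commutation q a b b' a') :
    a * b = b' * a' := by
  cases h with
  | theta_theta f g => rw [← coe_evalThetaHom, ← map_mul, mul_comm, map_mul]
  | theta_x f i => rw [← coe_evalThetaHom, evalThetaHom_mul_x]
  | theta_d f i => rw [← coe_evalThetaHom, evalThetaHom_mul_d]
  | x_x i j => exact x_mul_x q i j
  | d_d i j => exact d_mul_d q i j
  | x_d i j h => exact (d_mul_x_of_ne q h.symm).symm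

lemma Step.smul_prod_eq {F G : K × List (QWeyl q)} (h : Step q F G) :
    F.1 • F.2.prod = G.1 • G.2.prod := by
  cases h with
  | swap c u v a b b' a' h =>
    simp only [List.prod_append, List.prod_cons, List.prod_nil, mul_one, h.mul_eq]
  | swap_symm c u v a b b' a' h =>
    simp only [List.prod_append, List.prod_cons, List.prod_nil, mul_one, h.mul_eq]
  | rewrite_theta c u v i =>
    simp only [List.prod_append, List.prod_cons, List.prod_nil, mul_one, theta]
  | rewrite_theta_add c u v i =>
    simp only [List.prod_append, List.prod_cons, List.prod_nil, mul_one, d_mul_x_self_eq_smul,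
      mul_smul_comm, smul_mul_assoc, smul_smul, mul_assoc, inv_mul_cancel₀ (q i).ne_zero]
  | renormalize c a ha u v f =>
    simp only [List.prod_append, List.prod_cons, List.prod_nil, mul_one, mul_smul_comm,
      smul_mul_assoc, smul_smul]

lemma Step.append {c c' : K} {A B : List (QWeyl q)} (h : Step q (c, A) (c', B))
    (u v : List (QWeyl q)) : Step q (c, u ++ A ++ v) (c', u ++ B ++ v) := by
  cases h with
  | swap _ u' v' a b b' a' h => simpa using Step.swap c (u ++ u') (v' ++ v) a b b' a' h
  | swap_symm _ u' v' a b b' a' h => simpa using Step.swap_symm c (u ++ u') (v' ++ v) a b b' a' h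
  | rewrite_theta _ u' v' i => simpa using Step.rewrite_theta c (u ++ u') (v' ++ v) i
  | rewrite_theta_add _ u' v' i => simpa using Step.rewrite_theta_add c (u ++ u') (v' ++ v) i
  | renormalize _ a ha u' v' f => simpa using Step.renormalize c' a ha (u ++ u') (v' ++ v) f

lemma Derivable.refl (F : K × List (QWeyl q)) : Derivable q F F := Relation.ReflTransGen.refl

lemma Derivable.trans {F G H : K × List (QWeyl q)} (h : Derivable q F G) (h' : Derivable q G H) :
    Derivable q F H := Relation.ReflTransGen.trans h h'

lemma Step.derivable {F G : K × List (QWeyl q)} (h : Step q F G) : Derivable q F G :=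
  Relation.ReflTransGen.single h

lemma Derivable.smul_prod_eq {F G : K × List (QWeyl q)} (h : Derivable q F G) :
    F.1 • F.2.prod = G.1 • G.2.prod := by
  induction h with
  | refl => rfl
  | tail _ h ih => exact ih.trans h.smul_prod_eq

lemma Derivable.append {c c' : K} {A B : List (QWeyl q)} (h : Derivable q (c, A) (c', B))
    (u v : List (QWeyl q)) : Derivable q (c, u ++ A ++ v) (c', u ++ B ++ v) :=
  Relation.ReflTransGen.lift (fun F : K × List (QWeyl q) => (F.1, u ++ F.2 ++ v))
    (fun _ _ h => h.append u v) _ _ h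

lemma Derivable.append_left {c c' : K} {A B : List (QWeyl q)} (h : Derivable q (c, A) (c', B))
    (u : List (QWeyl q)) : Derivable q (c, u ++ A) (c', u ++ B) := by
  simpa using h.append u []

lemma Derivable.append_right {c c' : K} {A B : List (QWeyl q)} (h : Derivable q (c, A) (c', B))
    (v : List (QWeyl q)) : Derivable q (c, A ++ v) (c', B ++ v) :=
  h.append [] v

lemma Derivable.cons {c c' : K} {A B : List (QWeyl q)} (h : Derivable q (c, A) (c', B))
    (f : QWeyl q) : Derivable q (c, f :: A) (c', f :: B) :=
  h.append_left [f]

lemma Derivable.snd_eq_nil {c : K} {G : K × List (QWeyl q)} (h : Derivable q (c, []) G) :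
    G.2 = [] := by
  have hstep {F G : K × List (QWeyl q)} (h : Step q F G) : F.2 ≠ [] := by cases h <;> simp
  rcases Relation.ReflTransGen.cases_head h with rfl | ⟨F, hF, -⟩
  · rfl
  · exact absurd rfl (hstep hF)

lemma derivable_renormalize (c : K) {a : K} (ha : a ≠ 0) (f : QWeyl q) (v : List (QWeyl q)) :
    Derivable q (c * a, f :: v) (c, (a • f) :: v) :=
  (Step.renormalize c a ha [] v f).derivable

lemma Commutation.derivable {a b b' a' : QWeyl q} (h : Commutation q a b b' a') (c : K) :
    Derivable q (c, [a, b]) (c, [b', a']) :=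
  (Step.swap c [] [] a b b' a' h).derivable

lemma Commutation.derivable_symm {a b b' a' : QWeyl q} (h : Commutation q a b b' a') (c : K) :
    Derivable q (c, [b', a']) (c, [a, b]) :=
  (Step.swap_symm c [] [] a b b' a' h).derivable

lemma derivable_of_perm {c : K} {A B : List (QWeyl q)} (h : A.Perm B)
    (hA : ∀ a ∈ A, ∀ b ∈ A, Derivable q (c, [a, b]) (c, [b, a])) :
    Derivable q (c, A) (c, B) := by
  induction h with
  | nil => exact .refl _
  | cons a _ ih =>
    refine (ih fun a ha b hb => ?_).cons _
    exact hA a (List.mem_cons_of_mem _ ha) b (List.mem_cons_of_mem _ hb)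
  | swap a b l => exact (hA b (by simp) a (by simp)).append_right l
  | trans h₁ _ ih₁ ih₂ =>
    exact (ih₁ hA).trans (ih₂ fun a ha b hb => hA a (h₁.mem_iff.2 ha) b (h₁.mem_iff.2 hb))

lemma derivable_map_evalThetaHom_of_perm (c : K) {P P' : List (MvPolynomial (Fin n) K)}
    (h : P.Perm P') : Derivable q (c, P.map (evalThetaHom q)) (c, P'.map (evalThetaHom q)) := by
  refine derivable_of_perm (h.map _) fun a ha b hb => ?_
  obtain ⟨f, -, rfl⟩ := List.mem_map.mp ha
  obtain ⟨g, -, rfl⟩ := List.mem_map.mp hb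
  simp only [coe_evalThetaHom]
  exact (Commutation.theta_theta f g).derivable c

lemma derivable_of_perm_of_subset_factorsXD (c : K) {A B : List (QWeyl q)} (h : A.Perm B)
    {z : Fin n → ℤ} (hA : A ⊆ factorsXD q z) : Derivable q (c, A) (c, B) := by
  refine derivable_of_perm h fun a ha b hb => ?_
  rcases mem_factorsXD.mp (hA ha) with ⟨i, hi, rfl⟩ | ⟨i, hi, rfl⟩ <;>
    rcases mem_factorsXD.mp (hA hb) with ⟨j, hj, rfl⟩ | ⟨j, hj, rfl⟩
  · exact (Commutation.x_x i j).derivable c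
  · exact (Commutation.x_d i j (by rintro rfl; omega)).derivable c
  · exact (Commutation.x_d j i (by rintro rfl; omega)).derivable_symm c
  · exact (Commutation.d_d i j).derivable c

end Derivations

section Irreducible

lemma irreducible_shiftX (i : Fin n) {f : MvPolynomial (Fin n) K} (hf : Irreducible f) :
    Irreducible (shiftX q i f) :=
  (MulEquiv.irreducible_iff (shiftEquiv q i)).mpr hf

lemma irreducible_shiftD (i : Fin n) {f : MvPolynomial (Fin n) K} (hf : Irreducible f) :
    Irreducible (shiftD q i f) :=
  (MulEquiv.irreducible_iff (shiftEquiv q i).symm).mpr hf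

lemma irreducible_X_add_C (i : Fin n) :
    Irreducible (X i + C (q i : K)⁻¹ : MvPolynomial (Fin n) K) := by
  have hshift : shiftX q i (X i) = C (q i : K) * (X i + C (q i : K)⁻¹) := by
    rw [shiftX_X_self, mul_add, C_mul_C_inv]
  have hunit : IsUnit (C (q i : K) : MvPolynomial (Fin n) K) := (q i).isUnit.map C
  rw [← irreducible_isUnit_mul hunit, ← hshift]
  exact irreducible_shiftX q i X_prime.irreducible

lemma evalThetaHom_X_add_C (i : Fin n) :
    evalThetaHom q (X i + C (q i : K)⁻¹) = theta q i + algebraMap K (QWeyl q) (q i : K)⁻¹ := by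
  rw [map_add, evalThetaHom_X, ← algebraMap_eq, AlgHom.commutes]

lemma exists_map_evalTheta_eq_factorsT (t s : Fin n → ℕ) :
    ∃ T : List (MvPolynomial (Fin n) K),
      (∀ f ∈ T, Irreducible f) ∧ T.map (evalTheta q) = factorsT q t s := by
  refine ⟨(List.ofFn fun i => List.replicate (t i) (X i) ++
    List.replicate (s i) (X i + C (q i : K)⁻¹)).flatten, fun f hf => ?_, ?_⟩
  · simp only [List.mem_flatten, List.mem_ofFn] at hf
    obtain ⟨_, ⟨i, rfl⟩, hf⟩ := hf
    rcases List.mem_append.mp hf with hf | hf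
    · rw [List.eq_of_mem_replicate hf]
      exact X_prime.irreducible
    · rw [List.eq_of_mem_replicate hf]
      exact irreducible_X_add_C q i
  · rw [← coe_evalThetaHom, factorsT, List.map_flatten, List.map_ofFn]
    simp only [Function.comp_def, List.map_append, List.map_replicate, evalThetaHom_X,
      evalThetaHom_X_add_C]

end Irreducible

section NormalForms

variable {q}

/-- The elements of `Q_n` that occur as factors in the factorizations reachable by the operations:
up to a nonzero constant, an irreducible polynomial in `θ` or a generator. -/
inductive IsLetter : QWeyl q → Prop
  | evalThetaHom {f : MvPolynomial (Fin n) K} (hf : Irreducible f) : IsLetter (evalThetaHom q f)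
  | x (i : Fin n) : IsLetter (x q i)
  | d (i : Fin n) : IsLetter (d q i)
  | smul {a : K} (ha : a ≠ 0) {f : QWeyl q} (hf : IsLetter f) : IsLetter (a • f)

/-- A factorization in normal form `c • P(θ) * X^{e(z)} D^{w(z)}`, where `P(θ)` is given by its
list of irreducible factors. -/
inductive IsNormalForm : K × List (QWeyl q) → Prop
  | mk {c : K} (hc : c ≠ 0) {P : List (MvPolynomial (Fin n) K)} (hP : ∀ f ∈ P, Irreducible f)
      (z : Fin n → ℤ) : IsNormalForm (c, P.map (evalThetaHom q) ++ factorsXD q z)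

lemma isNormalForm_factorsXD {c : K} (hc : c ≠ 0) (z : Fin n → ℤ) :
    IsNormalForm (c, factorsXD q z) :=
  .mk hc (P := []) (List.forall_mem_nil _) z

lemma IsNormalForm.fst_ne_zero {F : K × List (QWeyl q)} (hF : IsNormalForm F) : F.1 ≠ 0 := by
  obtain @⟨c, hc, P, hP, z⟩ := hF
  exact hc

lemma IsNormalForm.isLetter {F : K × List (QWeyl q)} (hF : IsNormalForm F) :
    ∀ f ∈ F.2, IsLetter f := by
  obtain @⟨c, hc, P, hP, z⟩ := hF
  intro f hf
  rcases List.mem_append.mp hf with hf | hf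
  · obtain ⟨g, hg, rfl⟩ := List.mem_map.mp hf
    exact .evalThetaHom (hP g hg)
  · rcases mem_factorsXD.mp hf with ⟨i, -, rfl⟩ | ⟨i, -, rfl⟩
    exacts [.x i, .d i]

lemma IsNormalForm.append_left {c : K} {A : List (QWeyl q)} (h : IsNormalForm (c, A))
    {P : List (MvPolynomial (Fin n) K)} (hP : ∀ f ∈ P, Irreducible f) :
    IsNormalForm (c, P.map (evalThetaHom q) ++ A) := by
  generalize hF : (c, A) = F at h
  obtain @⟨c, hc, P', hP', z⟩ := h
  obtain ⟨rfl, rfl⟩ := Prod.mk.inj hF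
  rw [← List.append_assoc, ← List.map_append]
  exact .mk hc (List.forall_mem_append.mpr ⟨hP, hP'⟩) z

lemma exists_isNormalForm_x_cons_factorsXD {c : K} (hc : c ≠ 0) (i : Fin n) (z : Fin n → ℤ) :
    ∃ F, IsNormalForm F ∧ Derivable q F (c, x q i :: factorsXD q z) := by
  rcases le_or_gt (z i) 0 with hz | hz
  · exact ⟨_, isNormalForm_factorsXD hc (z - Pi.single i 1),
      derivable_of_perm_of_subset_factorsXD c (factorsXD_sub_single_perm q hz) (List.Subset.refl _)⟩
  · have hperm := factorsXD_add_single_perm (q := q) (z := z - Pi.single i 1) (i := i)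
      (by rw [Pi.sub_apply, Pi.single_eq_same]; omega)
    rw [sub_add_cancel] at hperm
    refine ⟨_, .mk hc (P := [X i]) (by simpa using X_prime.irreducible) (z - Pi.single i 1), ?_⟩
    rw [List.map_singleton, evalThetaHom_X]
    exact (Step.rewrite_theta c [] _ i).derivable.trans
      ((derivable_of_perm_of_subset_factorsXD c hperm.symm hperm.symm.subset).cons _)

lemma exists_isNormalForm_d_cons_factorsXD {c : K} (hc : c ≠ 0) (i : Fin n) (z : Fin n → ℤ) :
    ∃ F, IsNormalForm F ∧ Derivable q F (c, d q i :: factorsXD q z) := by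
  rcases le_or_gt 0 (z i) with hz | hz
  · exact ⟨_, isNormalForm_factorsXD hc (z + Pi.single i 1),
      derivable_of_perm_of_subset_factorsXD c (factorsXD_add_single_perm q hz) (List.Subset.refl _)⟩
  · have hperm := factorsXD_sub_single_perm (q := q) (z := z + Pi.single i 1) (i := i)
      (by rw [Pi.add_apply, Pi.single_eq_same]; omega)
    rw [add_sub_cancel_right] at hperm
    refine ⟨_, .mk (mul_ne_zero hc (q i).ne_zero) (P := [X i + C (q i : K)⁻¹])
      (by simpa using irreducible_X_add_C q i) (z + Pi.single i 1), ?_⟩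
    rw [List.map_singleton, evalThetaHom_X_add_C]
    have hrewrite := (Step.rewrite_theta_add (c * q i) [] (factorsXD q (z + Pi.single i 1))
      i).derivable
    rw [mul_inv_cancel_right₀ (q i).ne_zero] at hrewrite
    exact hrewrite.trans
      ((derivable_of_perm_of_subset_factorsXD c hperm.symm hperm.symm.subset).cons _)

lemma derivable_cons_map_evalThetaHom {c : K} {v : QWeyl q}
    {σ : MvPolynomial (Fin n) K → MvPolynomial (Fin n) K}
    (hv : ∀ f, Derivable q (c, [evalThetaHom q (σ f), v]) (c, [v, evalThetaHom q f]))
    (P : List (MvPolynomial (Fin n) K)) :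
    Derivable q (c, (P.map σ).map (evalThetaHom q) ++ [v]) (c, v :: P.map (evalThetaHom q)) := by
  induction P with
  | nil => exact .refl _
  | cons f P ih => exact (ih.cons _).trans ((hv f).append_right _)

lemma IsNormalForm.exists_cons {F : K × List (QWeyl q)} (hF : IsNormalForm F) {v : QWeyl q}
    {σ : MvPolynomial (Fin n) K → MvPolynomial (Fin n) K}
    (hσ : ∀ f, Irreducible f → Irreducible (σ f))
    (hv : ∀ c f, Derivable q (c, [evalThetaHom q (σ f), v]) (c, [v, evalThetaHom q f]))
    (hXD : ∀ c ≠ 0, ∀ z, ∃ G, IsNormalForm G ∧ Derivable q G (c, v :: factorsXD q z)) :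
    ∃ G, IsNormalForm G ∧ Derivable q G (F.1, v :: F.2) := by
  obtain @⟨c, hc, P, hP, z⟩ := hF
  obtain ⟨⟨c', L⟩, hG, hGv⟩ := hXD c hc z
  refine ⟨_, hG.append_left (P := P.map σ) (List.forall_mem_map.mpr fun f hf => hσ f (hP f hf)), ?_⟩
  have hmove := (derivable_cons_map_evalThetaHom (hv c) P).append_right (factorsXD q z)
  rw [List.append_assoc] at hmove
  exact (hGv.append_left _).trans hmove

lemma IsLetter.exists_isNormalForm_cons {f : QWeyl q} (hf : IsLetter f)
    {F : K × List (QWeyl q)} (hF : IsNormalForm F) :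
    ∃ G, IsNormalForm G ∧ Derivable q G (F.1, f :: F.2) := by
  induction hf generalizing F with
  | @evalThetaHom g hg =>
    exact ⟨_, hF.append_left (P := [g]) (List.forall_mem_singleton.mpr hg), .refl _⟩
  | x i =>
    refine hF.exists_cons (σ := shiftD q i) (fun f => irreducible_shiftD q i) (fun c f => ?_)
      fun c hc => exists_isNormalForm_x_cons_factorsXD hc i
    have h := (Commutation.theta_x (q := q) (shiftD q i f) i).derivable c
    rwa [shiftX_shiftD, ← coe_evalThetaHom] at h
  | d i =>
    refine hF.exists_cons (σ := shiftX q i) (fun f => irreducible_shiftX q i) (fun c f => ?_)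
      fun c hc => exists_isNormalForm_d_cons_factorsXD hc i
    have h := (Commutation.theta_d (q := q) (shiftX q i f) i).derivable c
    rwa [shiftD_shiftX, ← coe_evalThetaHom] at h
  | smul ha _ ih =>
    obtain @⟨c, hc, P, hP, z⟩ := hF
    obtain ⟨G, hG, hGf⟩ := ih (.mk (mul_ne_zero hc ha) hP z)
    exact ⟨G, hG, hGf.trans (derivable_renormalize c ha _ _)⟩

lemma exists_isNormalForm_derivable {c : K} (hc : c ≠ 0) {L : List (QWeyl q)}
    (hL : ∀ f ∈ L, IsLetter f) : ∃ F, IsNormalForm F ∧ Derivable q F (c, L) := by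
  induction L with
  | nil => exact ⟨_, isNormalForm_factorsXD hc 0, factorsXD_zero q ▸ .refl _⟩
  | cons f L ih =>
    obtain ⟨hf, hL⟩ := List.forall_mem_cons.mp hL
    obtain ⟨F, hF, hFL⟩ := ih hL
    obtain ⟨G, hG, hGF⟩ := hf.exists_isNormalForm_cons hF
    exact ⟨G, hG, hGF.trans (hFL.cons f)⟩

end NormalForms

section Uniqueness

variable {q}

lemma derivable_map_evalThetaHom_of_smul_prod_eq {c c' : K} (hc : c ≠ 0) (hc' : c' ≠ 0)
    {P P' : List (MvPolynomial (Fin n) K)} (hP : ∀ f ∈ P, Irreducible f)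
    (hP' : ∀ f ∈ P', Irreducible f) (h : c • P.prod = c' • P'.prod) :
    Derivable q (c, P.map (evalThetaHom q)) (c', P'.map (evalThetaHom q)) := by
  induction P generalizing c' P' with
  | nil =>
    rw [List.prod_nil] at h
    match P' with
    | [] =>
      rw [smul_left_injective K one_ne_zero h]
      exact .refl _
    | g :: L =>
      rw [List.prod_cons, smul_eq_C_mul, mul_one] at h
      refine absurd (isUnit_of_dvd_unit ?_ (hc.isUnit.map C)) (hP' g List.mem_cons_self).not_isUnit
      exact ⟨c' • L.prod, by rw [h, mul_smul_comm]⟩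
  | cons f P ih =>
    obtain ⟨hf, hP⟩ := List.forall_mem_cons.mp hP
    have hdvd : f ∣ P'.prod := by
      rw [← (hc'.isUnit.map C).dvd_mul_left, ← smul_eq_C_mul, ← h, List.prod_cons, ← mul_smul_comm]
      exact dvd_mul_right _ _
    obtain ⟨g, hg, hfg⟩ := hf.prime.dvd_prod_iff.mp hdvd
    obtain ⟨u, rfl⟩ := exists_unit_smul_eq_of_associated (hf.associated_of_dvd (hP' g hg) hfg)
    obtain ⟨A, B, rfl⟩ := List.append_of_mem hg
    have hrest : c • P.prod = (c' * u) • (A ++ B).prod := by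
      refine mul_left_cancel₀ hf.ne_zero ?_
      rw [mul_smul_comm, ← List.prod_cons, h, List.perm_middle.prod_eq, List.prod_cons, mul_smul,
        mul_smul_comm, mul_smul_comm, smul_mul_assoc]
    have hAB : ∀ g ∈ A ++ B, Irreducible g := fun g hg =>
      hP' g (List.perm_middle.symm.subset (List.mem_cons_of_mem _ hg))
    have hrenormalize := derivable_renormalize c' u.ne_zero (evalThetaHom q f)
      ((A ++ B).map (evalThetaHom q))
    rw [← map_smul] at hrenormalize
    exact (((ih (mul_ne_zero hc' u.ne_zero) hP hAB hrest).cons _).trans hrenormalize).trans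
      (derivable_map_evalThetaHom_of_perm c' List.perm_middle.symm)

lemma smul_prod_map_evalThetaHom_append_factorsXD (c : K) (P : List (MvPolynomial (Fin n) K))
    (z : Fin n → ℤ) : c • (P.map (evalThetaHom q) ++ factorsXD q z).prod =
      evalThetaHom q (c • P.prod) * (factorsXD q z).prod := by
  rw [List.prod_append, map_smul, map_list_prod, smul_mul_assoc]

lemma evalThetaHom_mul_prod_factorsXD_mem_homogeneous {f : MvPolynomial (Fin n) K} (hf : f ≠ 0)
    (z : Fin n → ℤ) : evalThetaHom q f * (factorsXD q z).prod ∈ homogeneous q z := by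
  simpa only [zero_add] using
    mul_mem_homogeneous (evalThetaHom_mem_homogeneous q hf) (prod_factorsXD_mem_homogeneous q z)

lemma smul_prod_ne_zero_of_irreducible {c : K} (hc : c ≠ 0) {P : List (MvPolynomial (Fin n) K)}
    (hP : ∀ f ∈ P, Irreducible f) : c • P.prod ≠ 0 :=
  smul_ne_zero hc (List.prod_ne_zero fun h => (hP 0 h).ne_zero rfl)

lemma IsNormalForm.isHomogeneous {F : K × List (QWeyl q)} (hF : IsNormalForm F) :
    IsHomogeneous q (F.1 • F.2.prod) := by
  obtain @⟨c, hc, P, hP, z⟩ := hF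
  refine ⟨z, ?_⟩
  rw [smul_prod_map_evalThetaHom_append_factorsXD]
  exact evalThetaHom_mul_prod_factorsXD_mem_homogeneous (smul_prod_ne_zero_of_irreducible hc hP) z

lemma IsNormalForm.derivable {F G : K × List (QWeyl q)} (hF : IsNormalForm F)
    (hG : IsNormalForm G) (h : F.1 • F.2.prod = G.1 • G.2.prod) : Derivable q F G := by
  obtain @⟨c, hc, P, hP, z⟩ := hF
  obtain @⟨c', hc', P', hP', z'⟩ := hG
  simp only [smul_prod_map_evalThetaHom_append_factorsXD] at h
  obtain rfl : z = z' := eq_of_mem_homogeneous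
    (evalThetaHom_mul_prod_factorsXD_mem_homogeneous (smul_prod_ne_zero_of_irreducible hc hP) z)
    (h ▸ evalThetaHom_mul_prod_factorsXD_mem_homogeneous
      (smul_prod_ne_zero_of_irreducible hc' hP') z')
  exact (derivable_map_evalThetaHom_of_smul_prod_eq hc hc' hP hP'
    (evalThetaHom_mul_left_cancel (prod_factorsXD_mem_homogeneous q z) h)).append_right _

lemma IsNormalForm.derivable_of_isLetter {F : K × List (QWeyl q)} (hF : IsNormalForm F)
    {c : K} (hc : c ≠ 0) {L : List (QWeyl q)} (hL : ∀ f ∈ L, IsLetter f)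
    (h : F.1 • F.2.prod = c • L.prod) : Derivable q F (c, L) := by
  obtain ⟨G, hG, hGL⟩ := exists_isNormalForm_derivable hc hL
  exact (hF.derivable hG (h.trans hGL.smul_prod_eq.symm)).trans hGL

end Uniqueness

section Spanning

lemma adjoin_range_x_union_range_d :
    Algebra.adjoin K (Set.range (x q) ∪ Set.range (d q)) = ⊤ := by
  have hrange : Set.range (x q) ∪ Set.range (d q) =
      RingQuot.mkAlgHom K (QWeylRel q) '' Set.range (FreeAlgebra.ι K) := by
    rw [← Set.range_comp, ← Set.Sum.elim_range]
    congr 1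
    funext v
    rcases v with i | i <;> rfl
  rw [hrange, ← AlgHom.map_adjoin, FreeAlgebra.adjoin_range_ι, Algebra.map_top,
    AlgHom.range_eq_top]
  exact RingQuot.mkAlgHom_surjective K (QWeylRel q)

/-- The map `(g_z)_z ↦ ∑_z g_z(θ) X^{e(z)} D^{w(z)}`, whose surjectivity says that `Q_n` is spanned
by elements of this form. -/
def thetaSum : ((Fin n → ℤ) →₀ MvPolynomial (Fin n) K) →ₗ[K] QWeyl q :=
  Finsupp.lsum K fun z =>
    LinearMap.mulRight K (factorsXD q z).prod ∘ₗ (evalThetaHom q).toLinearMap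

lemma thetaSum_single (z : Fin n → ℤ) (f : MvPolynomial (Fin n) K) :
    thetaSum q (Finsupp.single z f) = evalThetaHom q f * (factorsXD q z).prod :=
  Finsupp.lsum_single ..

lemma prod_mem_range_thetaSum {L : List (QWeyl q)} (hL : ∀ f ∈ L, IsLetter f) :
    L.prod ∈ LinearMap.range (thetaSum q) := by
  obtain ⟨F, @⟨c, hc, P, hP, z⟩, hFL⟩ := exists_isNormalForm_derivable one_ne_zero hL
  refine ⟨Finsupp.single z (c • P.prod), ?_⟩
  rw [thetaSum_single, ← smul_prod_map_evalThetaHom_append_factorsXD, hFL.smul_prod_eq, one_smul]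

lemma thetaSum_surjective : Function.Surjective (thetaSum q) := by
  rw [← LinearMap.range_eq_top, eq_top_iff, ← Algebra.top_toSubmodule,
    ← adjoin_range_x_union_range_d, Algebra.adjoin_eq_span, Submodule.span_le]
  intro f hf
  obtain ⟨L, hL, rfl⟩ := Submonoid.exists_list_of_mem_closure hf
  refine prod_mem_range_thetaSum q fun f hf => ?_
  rcases hL f hf with ⟨i, rfl⟩ | ⟨i, rfl⟩
  exacts [.x i, .d i]

lemma exists_coeff_toSkew_thetaSum (z : Fin n → ℤ) : ∃ r ≠ 0,
    ∀ G, (toSkew q (thetaSum q G)).coeff (degree q z) = G z * r := by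
  choose r hr hrXD using prod_factorsXD_mem_homogeneous q
  refine ⟨r z, hr z, fun G => ?_⟩
  induction G using Finsupp.induction_linear with
  | zero => simp
  | add G H hG hH =>
    rw [map_add, map_add, SkewMonoidAlgebra.coeff_add, Finsupp.add_apply, hG, hH,
      Finsupp.add_apply, add_mul]
  | single z' f =>
    rw [thetaSum_single, map_mul, toSkew_evalThetaHom, hrXD, SkewMonoidAlgebra.single_mul_single,
      one_mul, one_smul, SkewMonoidAlgebra.coeff_single]
    rcases eq_or_ne z z' with rfl | hz
    · rw [Finsupp.single_eq_same, Finsupp.single_eq_same]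
    · rw [Finsupp.single_eq_of_ne hz, Finsupp.single_eq_of_ne ((degree q).injective.ne hz),
        zero_mul]

variable {q}

lemma exists_eq_evalThetaHom_mul_of_mem_homogeneous {f : QWeyl q} {z : Fin n → ℤ}
    (hf : f ∈ homogeneous q z) : ∃ g ≠ 0, f = evalThetaHom q g * (factorsXD q z).prod := by
  obtain ⟨r, hr, hfr⟩ := hf
  obtain ⟨G, rfl⟩ := thetaSum_surjective q f
  have hcoeff (z' : Fin n → ℤ) : ∃ s ≠ 0,
      Finsupp.single (degree q z) r (degree q z') = G z' * s := by
    obtain ⟨s, hs, h⟩ := exists_coeff_toSkew_thetaSum q z'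
    exact ⟨s, hs, by rw [← h, hfr, SkewMonoidAlgebra.coeff_single]⟩
  refine ⟨G z, fun hG => ?_, ?_⟩
  · obtain ⟨s, -, h⟩ := hcoeff z
    rw [Finsupp.single_eq_same, hG, zero_mul] at h
    exact hr h
  · rw [← thetaSum_single]
    congr 1
    ext1 z'
    rcases eq_or_ne z' z with rfl | hz
    · rw [Finsupp.single_eq_same]
    · obtain ⟨s, hs, h⟩ := hcoeff z'
      rw [Finsupp.single_eq_of_ne ((degree q).injective.ne hz)] at h
      rw [Finsupp.single_eq_of_ne hz, (mul_eq_zero.mp h.symm).resolve_right hs]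

lemma IsHomogeneous.exists_isNormalForm {f : QWeyl q} (hf : IsHomogeneous q f) :
    ∃ F : K × List (QWeyl q), IsNormalForm F ∧ F.1 • F.2.prod = f := by
  obtain ⟨z, hf⟩ := hf
  obtain ⟨g, hg, rfl⟩ := exists_eq_evalThetaHom_mul_of_mem_homogeneous hf
  obtain ⟨s, hs, hsg⟩ := WfDvdMonoid.exists_factors g hg
  obtain ⟨P, rfl⟩ := Quot.exists_rep s
  obtain ⟨u, rfl⟩ := exists_unit_smul_eq_of_associated hsg
  exact ⟨_, .mk u.ne_zero hs z, smul_prod_map_evalThetaHom_append_factorsXD (u : K) P z⟩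

end Spanning

section Letters

variable {q}

lemma IsLetter.mul_ne_one {f : QWeyl q} (hf : IsLetter f) (g : QWeyl q) : f * g ≠ 1 := by
  intro hfg
  have hfg_hom : IsHomogeneous q (f * g) := hfg ▸ ⟨0, one_mem_homogeneous q⟩
  obtain ⟨⟨c, L⟩, hF, rfl⟩ := hfg_hom.of_mul.2.exists_isNormalForm
  have hone : (1 : K) • (factorsXD q 0).prod = c • (f :: L).prod := by
    rw [factorsXD_zero, List.prod_nil, one_smul, List.prod_cons, ← mul_smul_comm, hfg]
  have hderivable := (isNormalForm_factorsXD one_ne_zero 0).derivable_of_isLetter hF.fst_ne_zero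
    (List.forall_mem_cons.mpr ⟨hf, hF.isLetter⟩) hone
  rw [factorsXD_zero] at hderivable
  exact List.cons_ne_nil _ _ hderivable.snd_eq_nil

lemma IsHomogeneous.exists_isLetter_prod_eq {f : QWeyl q} (hf : IsHomogeneous q f)
    (hconst : f ∉ Set.range (algebraMap K (QWeyl q))) :
    ∃ L : List (QWeyl q), (∀ g ∈ L, IsLetter g) ∧ L.prod = f := by
  obtain ⟨⟨c, L⟩, hF, rfl⟩ := hf.exists_isNormalForm
  rcases L with - | ⟨g, L⟩
  · exact absurd ⟨c, Algebra.algebraMap_eq_smul_one c⟩ hconst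
  · obtain ⟨hg, hL⟩ := List.forall_mem_cons.mp hF.isLetter
    exact ⟨(c • g) :: L, List.forall_mem_cons.mpr ⟨.smul hF.fst_ne_zero hg, hL⟩,
      by rw [List.prod_cons, List.prod_cons, smul_mul_assoc]⟩

lemma IsHomogeneous.isLetter_of_irreducible {f : QWeyl q} (hf : IsHomogeneous q f)
    (hirr : Irreducible f) : IsLetter f := by
  have hconst : f ∉ Set.range (algebraMap K (QWeyl q)) := by
    rintro ⟨a, rfl⟩
    have ha : a ≠ 0 := by
      rintro rfl
      exact hirr.ne_zero (map_zero _)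
    exact hirr.not_isUnit (ha.isUnit.map _)
  obtain ⟨L, hL, rfl⟩ := hf.exists_isLetter_prod_eq hconst
  obtain ⟨g, rfl⟩ := exists_eq_singleton_of_irreducible_prod hirr fun g hg => (hL g hg).mul_ne_one
  rw [List.prod_singleton]
  exact hL g List.mem_cons_self

lemma IsNontrivialFactorization.isHomogeneous {p : QWeyl q} {F : K × List (QWeyl q)}
    (hF : IsNontrivialFactorization q p F) (hp : IsHomogeneous q p) :
    ∀ f ∈ F.2, IsHomogeneous q f := by
  rw [hF.2.2, Algebra.smul_def] at hp
  exact hp.of_mul.2.of_list_prod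

end Letters

end QWeyl

end

theorem mainTheorem3_general {K : Type*} [Field K] {n : ℕ} (q : Fin n → Kˣ) (z : Fin n → ℤ)
    (p : QWeyl q) (c₀ : K) (hc₀ : c₀ ≠ 0) (P : List (MvPolynomial (Fin n) K))
    (hP : ∀ f ∈ P, Irreducible f) (F₀ : K × List (QWeyl q))
    (hF₀ : F₀ = (c₀, P.map (QWeyl.evalTheta q) ++ QWeyl.factorsXD q z))
    (hpF₀ : p = F₀.1 • F₀.2.prod) :
    (∀ F : K × List (QWeyl q), QWeyl.IsNontrivialFactorization q p F →
      (∀ f ∈ F.2, Irreducible f) → QWeyl.Derivable q F₀ F) ∧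
    (∀ F : K × List (QWeyl q), QWeyl.IsNontrivialFactorization q p F →
      ∃ blocks : List (List (QWeyl q)), blocks.map List.prod = F.2 ∧
        QWeyl.Derivable q F₀ (F.1, blocks.flatten)) := by
  have hnormal : QWeyl.IsNormalForm F₀ := by
    rw [hF₀, ← QWeyl.coe_evalThetaHom]
    exact .mk hc₀ hP z
  have hp : QWeyl.IsHomogeneous q p := hpF₀ ▸ hnormal.isHomogeneous
  constructor
  · intro F hF hirr
    exact hnormal.derivable_of_isLetter hF.1
      (fun f hf => (hF.isHomogeneous hp f hf).isLetter_of_irreducible (hirr f hf))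
      (hpF₀.symm.trans hF.2.2)
  · intro F hF
    choose! block hletter hprod using fun f hf =>
      (hF.isHomogeneous hp f hf).exists_isLetter_prod_eq (hF.2.1 f hf)
    have hblocks : (F.2.map block).map List.prod = F.2 := by
      rw [List.map_map]
      exact (List.map_congr_left hprod).trans (List.map_id _)
    refine ⟨F.2.map block, hblocks, hnormal.derivable_of_isLetter hF.1 (fun g hg => ?_) ?_⟩
    · obtain ⟨_, hB, hg⟩ := List.mem_flatten.mp hg
      obtain ⟨f, hf, rfl⟩ := List.mem_map.mp hB
      exact hletter f hf g hg
    · rw [List.prod_flatten, hblocks, ← hpF₀, hF.2.2]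

theorem mainTheorem3 {K : Type*} [Field K] [CharZero K] {n : ℕ} (q : Fin n → Kˣ)
    (z : Fin n → ℤ) (p : QWeyl q) (hp : p ∈ QWeyl.gradedPart q z)
    -- one factorization `p = c₀ • Q(θ) * T(θ) * X^e D^w` with `e = e(z)`, `w = w(z)`
    (c₀ : K) (hc₀ : c₀ ≠ 0) (Q : List (MvPolynomial (Fin n) K))
    (hQ : ∀ f ∈ Q, Irreducible f ∧ Irreducible (QWeyl.evalTheta q f))
    (t s : Fin n → ℕ) (F₀ : K × List (QWeyl q))
    (hF₀ : F₀ = (c₀, Q.map (QWeyl.evalTheta q) ++ QWeyl.factorsT q t s ++ QWeyl.factorsXD q z))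
    (hpF₀ : p = F₀.1 • F₀.2.prod) :
    -- every factorization into irreducible factors is derived from it
    (∀ F : K × List (QWeyl q), QWeyl.IsNontrivialFactorization q p F →
      (∀ f ∈ F.2, Irreducible f) → QWeyl.Derivable q F₀ F) ∧
    -- every factorization is derived from it, up to multiplying together adjacent factors
    (∀ F : K × List (QWeyl q), QWeyl.IsNontrivialFactorization q p F →
      ∃ blocks : List (List (QWeyl q)), blocks.map List.prod = F.2 ∧
        QWeyl.Derivable q F₀ (F.1, blocks.flatten)) := by
  obtain ⟨T, hT, hT_eq⟩ := QWeyl.exists_map_evalTheta_eq_factorsT q t s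
  refine mainTheorem3_general q z p c₀ hc₀ (Q ++ T)
    (List.forall_mem_append.mpr ⟨fun f hf => (hQ f hf).1, hT⟩) F₀ ?_ hpF₀
  rw [hF₀, List.map_append, hT_eq]
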